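/- Let $m,n\ge 0$ and $r\ge 1$ be integers, and let $f:\mathbb{R}^{m\times n}\to\mathbb{R}$ be twice differentiable with gradient $\nabla f(X)\in\mathbb{R}^{m\times n}$. Write $\langle\cdot,\cdot\rangle$ and $\|\cdot\|_F$ for the Frobenius inner product and norm. Let $\alpha,\beta>0$, and assume that for all $X,Y\in\mathbb{R}^{m\times n}$ with $\operatorname{rank}(X),\operatorname{rank}(Y)\le r$, $$f(X)+\langle\nabla f(X),Y-X\rangle+\tfrac{\alpha}{2}\|X-Y\|_F^2\;\le\; f(Y)\;\le\; f(X)+\langle\nabla f(X),Y-X\rangle+\tfrac{\beta}{2}\|X-Y\|_F^2$$ ($\alpha$-restricted strong convexity and $\beta$-restricted smoothness with respect to rank $r$). Put $\kappa=\beta/\alpha$. Then the minimum $\min_{\operatorname{rank}(Y)<r/\kappa^2}f(Y)$ over $Y\in\mathbb{R}^{m\times n}$ is attained, and: 1. If $X\in\mathbb{R}^{m\times n}$ is a stationary point of projected gradient descent with rank constraint $r$ and step size $\eta=1/\beta$, that is, $\operatorname{rank}(X)\le r$ and $X\in\arg\min_{\operatorname{rank}(X')\le r}\|X'-(X-\eta\nabla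 f(X))\|_F$, then $$f(X)\le\min_{\operatorname{rank}(Y)<r/\kappa^2}f(Y).$$ 2. If $(A,B)\in\mathbb{R}^{m\times r}\times\mathbb{R}^{n\times r}$ is a second-order stationary point of the factorized objective $g(A,B)=f(AB^\top)$, that is, $\nabla g(A,B)=0$ and $\nabla^2 g(A,B)\succeq 0$, then $$f(AB^\top)\le\min_{\operatorname{rank}(Y)<r/\kappa^2}f(Y).$$ -/

import Mathlib

namespace LowRankOpt

open scoped Matrix Matrix.Norms.Frobenius

variable {m n r : ℕ}

/-- The Frobenius inner product `⟨G, H⟩ = ∑ᵢⱼ Gᵢⱼ Hᵢⱼ`. -/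
def frobInner (G H : Matrix (Fin m) (Fin n) ℝ) : ℝ :=
  ∑ i, ∑ j, G i j * H i j

/-- `f` is twice (Fréchet) differentiable on the whole matrix space. -/
def TwiceDifferentiable (f : Matrix (Fin m) (Fin n) ℝ → ℝ) : Prop :=
  Differentiable ℝ f ∧ Differentiable ℝ (fderiv ℝ f)

/-- The gradient of `f` at `X`, as the matrix of partial derivatives. -/
noncomputable def gradMatrix (f : Matrix (Fin m) (Fin n) ℝ → ℝ)
    (X : Matrix (Fin m) (Fin n) ℝ) : Matrix (Fin m) (Fin n) ℝ :=
  Matrix.of fun i j => fderiv ℝ f X (Matrix.single i j 1)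

/-- `α`-restricted strong convexity with respect to the rank constraint `r`;
`‖·‖` is the Frobenius norm. -/
def RestrictedStronglyConvex (f : Matrix (Fin m) (Fin n) ℝ → ℝ) (r : ℕ) (α : ℝ) : Prop :=
  ∀ X Y : Matrix (Fin m) (Fin n) ℝ, X.rank ≤ r → Y.rank ≤ r →
    f X + frobInner (gradMatrix f X) (Y - X) + α / 2 * ‖X - Y‖ ^ 2 ≤ f Y

/-- `β`-restricted smoothness with respect to the rank constraint `r`. -/
def RestrictedSmooth (f : Matrix (Fin m) (Fin n) ℝ → ℝ) (r : ℕ) (β : ℝ) : Prop :=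
  ∀ X Y : Matrix (Fin m) (Fin n) ℝ, X.rank ≤ r → Y.rank ≤ r →
    f Y ≤ f X + frobInner (gradMatrix f X) (Y - X) + β / 2 * ‖X - Y‖ ^ 2

/-- `X` is a (possibly non-unique) Frobenius-norm projection of `Z` to the set of matrices of
rank at most `r`. -/
def IsRankProjection (r : ℕ) (Z X : Matrix (Fin m) (Fin n) ℝ) : Prop :=
  X.rank ≤ r ∧ ∀ X' : Matrix (Fin m) (Fin n) ℝ, X'.rank ≤ r → ‖X - Z‖ ≤ ‖X' - Z‖

/-- `X` is a stationary point of projected gradient descent on `f` with rank constraint `r` and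
step size `η`. -/
def IsPGDStationary (f : Matrix (Fin m) (Fin n) ℝ → ℝ) (r : ℕ) (η : ℝ)
    (X : Matrix (Fin m) (Fin n) ℝ) : Prop :=
  IsRankProjection r (X - η • gradMatrix f X) X

/-- The factorized objective `g (A, B) = f (A Bᵀ)`. -/
def factorized (f : Matrix (Fin m) (Fin n) ℝ → ℝ) (r : ℕ) :
    Matrix (Fin m) (Fin r) ℝ × Matrix (Fin n) (Fin r) ℝ → ℝ :=
  fun p => f (p.1 * p.2ᵀ)

/-- `p = (A, B)` is a second-order stationary point of the factorized problem: the derivative of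
the factorized objective vanishes at `p` and its second derivative there is positive
semidefinite. -/
def IsFactorizedSOSP (f : Matrix (Fin m) (Fin n) ℝ → ℝ) (r : ℕ)
    (p : Matrix (Fin m) (Fin r) ℝ × Matrix (Fin n) (Fin r) ℝ) : Prop :=
  fderiv ℝ (factorized f r) p = 0 ∧
    ∀ d : Matrix (Fin m) (Fin r) ℝ × Matrix (Fin n) (Fin r) ℝ,
      0 ≤ fderiv ℝ (fderiv ℝ (factorized f r)) p d d

end LowRankOpt

/-!
Both kinds of stationarity force the gradient `G = ∇f(X)` to be orthogonal to the row and column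
spaces of `X` and to have operator norm at most `β σᵣ(X)`: otherwise one could gain by trading a
singular direction of `X` for a singular direction of `G`. So some threshold `c` satisfies
`‖Gᵀ u‖² ≤ β² c ‖u‖²` for all `u` and `c ‖w‖² ≤ ‖Xᵀ w‖²` for all `w` in the column space of `X`.

Now let `s = rank Y ≤ r / κ²`, let `P` be an orthonormal basis of the column space of `Y` and `W`
one of the column space of `X`, and put `p = ‖Pᵀ W‖² ≤ s`. If `rank X = r`, projecting gives
`‖Pᵀ G‖² ≤ β² c (s - p)` and `c (r - p) ≤ ‖X - P Pᵀ X‖²`, and `s β² ≤ r α²` yields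
`β² (s - p) ≤ α² (r - p)`, so `‖Pᵀ G‖² ≤ α² ‖X - P Pᵀ X‖²`; if `rank X < r`, then `G = 0`.
Since `X` and `G` are orthogonal, this says that the distance of `α X - G` to the matrices with
column space in the range of `P`, in particular to `α Y`, is at least `‖G‖`. Expanding
`‖α X - G - α Y‖² ≥ ‖G‖²` shows that the strong convexity lower bound for `f Y` is at least `f X`.
-/

namespace LowRankOpt

open scoped Matrix Matrix.Norms.Frobenius InnerProductSpace
open Matrix Filter Topology

theorem norm_smul_sq {E : Type*} [NormedAddCommGroup E] [NormedSpace ℝ E] (c : ℝ) (x : E) :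
    ‖c • x‖ ^ 2 = c ^ 2 * ‖x‖ ^ 2 := by
  rw [norm_smul, mul_pow, Real.norm_eq_abs, sq_abs]

theorem norm_sq_eq_trace {m n : Type*} [Fintype m] [Fintype n] (M : Matrix m n ℝ) :
    ‖M‖ ^ 2 = (Mᵀ * M).trace := by
  rw [frobenius_norm_def, ← Real.sqrt_eq_rpow, Real.sq_sqrt (by positivity), Finset.sum_comm]
  simp [trace, mul_apply, pow_two]

/-- The inner product space structure on real matrices with `⟪G, H⟫ = tr (Gᵀ H)`, whose norm is
definitionally Mathlib's scoped Frobenius norm; it agrees with `frobInner`, see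
`frobInner_eq_inner`. -/
noncomputable abbrev frobeniusInnerProductSpace {m n : Type*} [Fintype m] [Fintype n] :
    InnerProductSpace ℝ (Matrix m n ℝ) where
  toNormedSpace := Matrix.frobeniusNormedSpace
  inner G H := (Gᵀ * H).trace
  norm_sq_eq_re_inner := norm_sq_eq_trace
  conj_inner_symm G H := by
    rw [conj_trivial, ← trace_transpose, transpose_mul, transpose_transpose]
  add_left G H K := by rw [transpose_add, Matrix.add_mul, trace_add]
  smul_left G H c := by simp

attribute [local instance] frobeniusInnerProductSpace

section FrobeniusInner

variable {m n k : Type*} [Fintype m] [Fintype n] [Fintype k]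

theorem dotProduct_self_nonneg (u : m → ℝ) : 0 ≤ u ⬝ᵥ u :=
  Finset.sum_nonneg fun _ _ => mul_self_nonneg _

theorem dotProduct_self_pos {u : m → ℝ} (hu : u ≠ 0) : 0 < u ⬝ᵥ u :=
  (dotProduct_self_nonneg u).lt_of_ne' (mt dotProduct_self_eq_zero.1 hu)

theorem frobInner_eq_inner {m n : ℕ} (G H : Matrix (Fin m) (Fin n) ℝ) :
    frobInner G H = ⟪G, H⟫_ℝ := by
  simp only [frobInner, inner, trace, diag_apply, mul_apply, transpose_apply]
  exact Finset.sum_comm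

theorem inner_matrix_mul (A : Matrix m k ℝ) (B : Matrix k n ℝ) (C : Matrix m n ℝ) :
    ⟪C, A * B⟫_ℝ = ⟪Aᵀ * C, B⟫_ℝ := by
  simp [inner, Matrix.mul_assoc]

theorem inner_matrix_mul' (A : Matrix m k ℝ) (B : Matrix k n ℝ) (C : Matrix m n ℝ) :
    ⟪C, A * B⟫_ℝ = ⟪C * Bᵀ, A⟫_ℝ := by
  simp only [inner, transpose_mul, transpose_transpose]
  rw [← Matrix.mul_assoc, trace_mul_comm, Matrix.mul_assoc]

theorem inner_vecMulVec (C : Matrix m n ℝ) (u : m → ℝ) (v : n → ℝ) :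
    ⟪C, vecMulVec u v⟫_ℝ = (u ᵥ* C) ⬝ᵥ v := by
  simp only [inner, mul_vecMulVec, trace_vecMulVec, mulVec_transpose]

theorem norm_vecMulVec_sq (u : m → ℝ) (v : n → ℝ) :
    ‖vecMulVec u v‖ ^ 2 = (u ⬝ᵥ u) * (v ⬝ᵥ v) := by
  rw [← real_inner_self_eq_norm_sq, inner_vecMulVec, vecMul_vecMulVec, smul_dotProduct,
    smul_eq_mul]

theorem norm_vecMulVec_add_vecMulVec_sq {v w : n → ℝ} (h : v ⬝ᵥ w = 0) (u z : m → ℝ) :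
    ‖vecMulVec u v + vecMulVec z w‖ ^ 2 = (u ⬝ᵥ u) * (v ⬝ᵥ v) + (z ⬝ᵥ z) * (w ⬝ᵥ w) := by
  have horth : ⟪vecMulVec u v, vecMulVec z w⟫_ℝ = 0 := by
    rw [inner_vecMulVec, vecMul_vecMulVec, smul_dotProduct, h, smul_zero]
  rw [norm_add_sq_real, norm_vecMulVec_sq, norm_vecMulVec_sq, horth, mul_zero, add_zero]

theorem vecMul_dotProduct_vecMul_eq_zero {G X : Matrix m n ℝ} (h : G * Xᵀ = 0) (u w : m → ℝ) :
    (w ᵥ* X) ⬝ᵥ (u ᵥ* G) = 0 := by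
  rw [dotProduct_comm, ← mulVec_transpose X, dotProduct_mulVec, vecMul_vecMul, h, vecMul_zero,
    zero_dotProduct]

theorem eq_zero_of_forall_inner_vecMulVec_eq_zero {M : Matrix m n ℝ}
    (h : ∀ u v, ⟪M, vecMulVec u v⟫_ℝ = 0) : M = 0 := by
  classical
  ext i j
  simpa [inner_vecMulVec] using h (Pi.single i 1) (Pi.single j 1)

theorem norm_sq_eq_sum_dotProduct (M : Matrix m n ℝ) : ‖M‖ ^ 2 = ∑ i, M i ⬝ᵥ M i := by
  rw [norm_sq_eq_trace, trace_mul_comm]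
  rfl

theorem norm_mul_sq_le {c : ℝ} {G : Matrix m n ℝ}
    (h : ∀ u, (u ᵥ* G) ⬝ᵥ (u ᵥ* G) ≤ c * (u ⬝ᵥ u)) (N : Matrix k m ℝ) :
    ‖N * G‖ ^ 2 ≤ c * ‖N‖ ^ 2 := by
  rw [norm_sq_eq_sum_dotProduct, norm_sq_eq_sum_dotProduct, Finset.mul_sum]
  exact Finset.sum_le_sum fun i _ => h (N i)

theorem le_norm_mul_sq {c : ℝ} {G : Matrix m n ℝ}
    (h : ∀ u, c * (u ⬝ᵥ u) ≤ (u ᵥ* G) ⬝ᵥ (u ᵥ* G)) (N : Matrix k m ℝ) :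
    c * ‖N‖ ^ 2 ≤ ‖N * G‖ ^ 2 := by
  rw [norm_sq_eq_sum_dotProduct, norm_sq_eq_sum_dotProduct, Finset.mul_sum]
  exact Finset.sum_le_sum fun i _ => h (N i)

theorem norm_transpose_mul_comm (P : Matrix m k ℝ) (W : Matrix m n ℝ) :
    ‖Wᵀ * P‖ = ‖Pᵀ * W‖ := by
  rw [← frobenius_norm_transpose, transpose_mul, transpose_transpose]

theorem norm_replicateRow_sq (u : m → ℝ) : ‖replicateRow Unit u‖ ^ 2 = u ⬝ᵥ u :=
  (norm_sq_eq_sum_dotProduct _).trans (Fintype.sum_unique _)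

theorem vecMul_dotProduct_self_le (G : Matrix m n ℝ) (u : m → ℝ) :
    (u ᵥ* G) ⬝ᵥ (u ᵥ* G) ≤ ‖G‖ ^ 2 * (u ⬝ᵥ u) := by
  rw [← norm_replicateRow_sq, ← norm_replicateRow_sq, replicateRow_vecMul, mul_comm, ← mul_pow]
  gcongr
  exact frobenius_norm_mul _ _

end FrobeniusInner

section Rank

variable {m n k K : Type*} [Fintype n] [Field K]

theorem rank_add_vecMulVec_le (M : Matrix m n K) (u : m → K) (v : n → K) :
    (M + vecMulVec u v).rank ≤ M.rank + 1 := by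
  have hle : LinearMap.range (M + vecMulVec u v).mulVecLin ≤
      LinearMap.range M.mulVecLin ⊔ LinearMap.range (vecMulVec u v).mulVecLin := by
    rw [mulVecLin_add]
    exact LinearMap.range_add_le _ _
  calc (M + vecMulVec u v).rank ≤ _ := Submodule.finrank_mono hle
    _ ≤ M.rank + (vecMulVec u v).rank := Submodule.finrank_add_le_finrank_add_finrank _ _
    _ ≤ M.rank + 1 := Nat.add_le_add_left (rank_vecMulVec_le u v) _

-- Wedderburn rank reduction: `y` annihilates the new column space, but not `X *ᵥ x`.
theorem rank_add_vecMulVec_lt [Fintype m] (X : Matrix m n K) {x : n → K} {y : m → K}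
    (h : y ⬝ᵥ (X *ᵥ x) ≠ 0) :
    (X + vecMulVec (-(y ⬝ᵥ (X *ᵥ x))⁻¹ • (X *ᵥ x)) (y ᵥ* X)).rank < X.rank := by
  set a := y ⬝ᵥ (X *ᵥ x) with ha
  have hmulVec (v : n → K) : (X + vecMulVec (-a⁻¹ • (X *ᵥ x)) (y ᵥ* X)) *ᵥ v =
      X *ᵥ v + ((y ᵥ* X) ⬝ᵥ v * -a⁻¹) • (X *ᵥ x) := by
    rw [add_mulVec, vecMulVec_mulVec, op_smul_eq_smul, smul_smul]
  refine Submodule.finrank_lt_finrank_of_lt (lt_of_le_of_ne ?_ fun heq => ?_)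
  · rintro _ ⟨v, rfl⟩
    refine ⟨v + ((y ᵥ* X) ⬝ᵥ v * -a⁻¹) • x, ?_⟩
    rw [mulVecLin_apply, mulVecLin_apply, hmulVec, mulVec_add, mulVec_smul]
  · obtain ⟨v, hv⟩ := heq.ge ⟨x, rfl⟩
    rw [mulVecLin_apply, mulVecLin_apply, hmulVec] at hv
    refine h ?_
    rw [ha, ← hv, dotProduct_add, dotProduct_smul, ← ha, ← dotProduct_mulVec, smul_eq_mul,
      mul_neg, neg_mul, inv_mul_cancel_right₀ h, add_neg_cancel]

theorem exists_mulVec_eq_zero_of_rank_mul_transpose_lt [Fintype k] {A : Matrix m k K}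
    {B : Matrix n k K} (h : (A * Bᵀ).rank < Fintype.card k) :
    ∃ z ≠ 0, A *ᵥ z = 0 ∨ B *ᵥ z = 0 := by
  by_contra! hne
  have hA : Function.Injective A.mulVecLin :=
    (injective_iff_map_eq_zero _).2 fun z hz => by_contra fun h0 => (hne z h0).1 hz
  have hB : Function.Injective B.mulVecLin :=
    (injective_iff_map_eq_zero _).2 fun z hz => by_contra fun h0 => (hne z h0).2 hz
  have hrank : (A * Bᵀ).rank = Bᵀ.rank := by
    rw [rank, mulVecLin_mul, LinearMap.range_comp]
    exact (Submodule.equivMapOfInjective _ hA _).finrank_eq.symm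
  rw [hrank, rank_transpose, rank, LinearMap.finrank_range_of_inj hB,
    Module.finrank_fintype_fun_eq_card] at h
  exact h.false

theorem exists_mul_eq_of_range_le [Fintype k] {M : Matrix m n K} {N : Matrix m k K}
    (h : LinearMap.range N.mulVecLin ≤ LinearMap.range M.mulVecLin) :
    ∃ L : Matrix n k K, M * L = N := by
  classical
  choose x hx using fun j => h ⟨Pi.single j 1, rfl⟩
  refine ⟨(of x)ᵀ, ext_of_mulVec_single fun j => ?_⟩
  rw [← mulVec_mulVec, mulVec_single_one]
  exact hx j

end Rank

section OrthonormalColumns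

variable {m n k l : Type*} [Fintype m] [Fintype n] [Fintype k] [Fintype l]
  [DecidableEq k] [DecidableEq l]

theorem exists_orthonormal_range_eq (S : Submodule ℝ (m → ℝ)) :
    ∃ W : Matrix m (Fin (Module.finrank ℝ S)) ℝ, Wᵀ * W = 1 ∧ LinearMap.range W.mulVecLin = S := by
  let e := (WithLp.linearEquiv 2 ℝ (m → ℝ)).symm
  let b : OrthonormalBasis (Fin (Module.finrank ℝ S)) ℝ (S.map e.toLinearMap) :=
    (stdOrthonormalBasis ℝ _).reindex (finCongr (e.finrank_map_eq S))
  let W : Matrix m (Fin (Module.finrank ℝ S)) ℝ := of fun i j => (b j : EuclideanSpace ℝ m) i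
  refine ⟨W, ?_, ?_⟩
  · ext i j
    have hij := orthonormal_iff_ite.1 b.orthonormal i j
    rw [Submodule.coe_inner, EuclideanSpace.inner_eq_star_dotProduct] at hij
    rw [one_apply, ← hij, dotProduct_comm]
    rfl
  · have hcol : Set.range W.col =
        e.symm.toLinearMap '' ((S.map e.toLinearMap).subtype '' Set.range b) := by
      rw [← Set.range_comp, ← Set.range_comp]
      rfl
    have hb : Submodule.span ℝ (Set.range b) = ⊤ := by
      rw [← b.coe_toBasis, b.toBasis.span_eq]
    rw [range_mulVecLin, hcol, Submodule.span_image, Submodule.span_image, hb, Submodule.map_top,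
      Submodule.range_subtype, ← Submodule.map_comp, e.symm_comp, Submodule.map_id]

theorem exists_orthonormal_mul_eq (M : Matrix m n ℝ) :
    ∃ (W : Matrix m (Fin M.rank) ℝ) (L : Matrix n (Fin M.rank) ℝ),
      Wᵀ * W = 1 ∧ W * (Wᵀ * M) = M ∧ M * L = W := by
  obtain ⟨W, hW, hrange⟩ := exists_orthonormal_range_eq (LinearMap.range M.mulVecLin)
  obtain ⟨L, hL⟩ := exists_mul_eq_of_range_le hrange.le
  obtain ⟨N, hN⟩ := exists_mul_eq_of_range_le hrange.ge
  refine ⟨W, L, hW, ?_, hL⟩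
  calc W * (Wᵀ * M) = W * (Wᵀ * (W * N)) := by rw [hN]
    _ = W * N := by rw [← Matrix.mul_assoc Wᵀ, hW, Matrix.one_mul]
    _ = M := hN

theorem norm_mul_sq_of_orthonormal {P : Matrix m k ℝ} (hP : Pᵀ * P = 1) (N : Matrix k n ℝ) :
    ‖P * N‖ ^ 2 = ‖N‖ ^ 2 := by
  rw [← real_inner_self_eq_norm_sq, ← real_inner_self_eq_norm_sq, inner_matrix_mul,
    ← Matrix.mul_assoc, hP, Matrix.one_mul]

theorem norm_sub_proj_sq {P : Matrix m k ℝ} (hP : Pᵀ * P = 1) (M : Matrix m n ℝ) :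
    ‖M - P * (Pᵀ * M)‖ ^ 2 = ‖M‖ ^ 2 - ‖Pᵀ * M‖ ^ 2 := by
  rw [norm_sub_sq_real, norm_mul_sq_of_orthonormal hP, inner_matrix_mul,
    real_inner_self_eq_norm_sq]
  ring

theorem norm_sub_proj_sq_le {P : Matrix m k ℝ} (hP : Pᵀ * P = 1) (M : Matrix m n ℝ)
    {Y : Matrix m n ℝ} (hY : P * (Pᵀ * Y) = Y) :
    ‖M - P * (Pᵀ * M)‖ ^ 2 ≤ ‖M - Y‖ ^ 2 := by
  have hsub : M - P * (Pᵀ * M) = M - Y - P * (Pᵀ * (M - Y)) := by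
    rw [Matrix.mul_sub, Matrix.mul_sub, hY, sub_sub_sub_cancel_right]
  rw [hsub, norm_sub_proj_sq hP]
  exact sub_le_self _ (sq_nonneg _)

theorem norm_sub_proj_sq_of_orthonormal {P : Matrix m k ℝ} (hP : Pᵀ * P = 1) {W : Matrix m l ℝ}
    (hW : Wᵀ * W = 1) : ‖W - P * (Pᵀ * W)‖ ^ 2 = Fintype.card l - ‖Pᵀ * W‖ ^ 2 := by
  rw [norm_sub_proj_sq hP, norm_sq_eq_trace W, hW, trace_one]

theorem norm_transpose_mul_sq_le_card {P : Matrix m k ℝ} (hP : Pᵀ * P = 1) {W : Matrix m l ℝ}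
    (hW : Wᵀ * W = 1) : ‖Pᵀ * W‖ ^ 2 ≤ Fintype.card k := by
  rw [← norm_transpose_mul_comm, ← sub_nonneg, ← norm_sub_proj_sq_of_orthonormal hW hP]
  exact sq_nonneg _

theorem norm_transpose_mul_sq_le {c : ℝ} {P : Matrix m k ℝ} (hP : Pᵀ * P = 1) {W : Matrix m l ℝ}
    (hW : Wᵀ * W = 1) {G : Matrix m n ℝ} (hWG : Wᵀ * G = 0)
    (hG : ∀ u, (u ᵥ* G) ⬝ᵥ (u ᵥ* G) ≤ c * (u ⬝ᵥ u)) :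
    ‖Pᵀ * G‖ ^ 2 ≤ c * (Fintype.card k - ‖Pᵀ * W‖ ^ 2) := by
  have hres : Pᵀ * G = (P - W * (Wᵀ * P))ᵀ * G := by
    rw [transpose_sub, transpose_mul, Matrix.sub_mul, Matrix.mul_assoc _ Wᵀ, hWG, Matrix.mul_zero,
      sub_zero]
  calc ‖Pᵀ * G‖ ^ 2 ≤ c * ‖(P - W * (Wᵀ * P))ᵀ‖ ^ 2 := hres ▸ norm_mul_sq_le hG _
    _ = c * (Fintype.card k - ‖Pᵀ * W‖ ^ 2) := by
      rw [frobenius_norm_transpose, norm_sub_proj_sq_of_orthonormal hW hP, norm_transpose_mul_comm]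

theorem le_norm_sub_proj_sq {c : ℝ} {P : Matrix m k ℝ} (hP : Pᵀ * P = 1) {W : Matrix m l ℝ}
    (hW : Wᵀ * W = 1) {X : Matrix m n ℝ} (hWX : W * (Wᵀ * X) = X)
    (hX : ∀ y, c * (y ⬝ᵥ y) ≤ (y ᵥ* (Wᵀ * X)) ⬝ᵥ (y ᵥ* (Wᵀ * X))) :
    c * (Fintype.card l - ‖Pᵀ * W‖ ^ 2) ≤ ‖X - P * (Pᵀ * X)‖ ^ 2 := by
  have hres : X - P * (Pᵀ * X) = (W - P * (Pᵀ * W)) * (Wᵀ * X) := by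
    rw [Matrix.sub_mul, hWX, Matrix.mul_assoc, Matrix.mul_assoc Pᵀ, hWX]
  rw [← norm_sub_proj_sq_of_orthonormal hP hW, hres]
  exact le_norm_mul_sq hX _

end OrthonormalColumns

section SpectralStationarity

/-- The common consequence of both kinds of stationarity of `X`, where `G` is the gradient at `X`:
`X` has rank at most `r`, `G` is orthogonal to the row and column spaces of `X`, and the operator
norm of `G` is at most `β` times the `r`-th singular value of `X`. The last condition is encoded
without singular values, by comparing Rayleigh quotients of `G Gᵀ` with those of `X Xᵀ` on the
column space of `X`; if `X` has rank less than `r`, its `r`-th singular value is `0`. -/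
structure IsSpectrallyStationary {m n : Type*} [Fintype m] [Fintype n] (r : ℕ) (β : ℝ)
    (X G : Matrix m n ℝ) : Prop where
  rank_le : X.rank ≤ r
  mul_transpose_eq_zero : G * Xᵀ = 0
  transpose_mul_eq_zero : Xᵀ * G = 0
  eq_zero_of_rank_lt : X.rank < r → G = 0
  opNorm_le : ∀ u x, ((u ᵥ* G) ⬝ᵥ (u ᵥ* G)) * ((X *ᵥ x) ⬝ᵥ (X *ᵥ x)) ≤
    ((X *ᵥ x) ᵥ* X) ⬝ᵥ ((X *ᵥ x) ᵥ* X) * (β ^ 2 * (u ⬝ᵥ u))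

variable {m n k : Type*} [Fintype m] [Fintype n] [Fintype k] {r : ℕ} {α β : ℝ}
  {X Y G : Matrix m n ℝ}

theorem IsSpectrallyStationary.exists_threshold (hβ : 0 < β) (h : IsSpectrallyStationary r β X G) :
    ∃ c : ℝ, 0 ≤ c ∧ (∀ u, (u ᵥ* G) ⬝ᵥ (u ᵥ* G) ≤ β ^ 2 * c * (u ⬝ᵥ u)) ∧
      ∀ x, c * ((X *ᵥ x) ⬝ᵥ (X *ᵥ x)) ≤ ((X *ᵥ x) ᵥ* X) ⬝ᵥ ((X *ᵥ x) ᵥ* X) := by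
  by_cases hX : ∀ x, X *ᵥ x = 0
  · refine ⟨‖G‖ ^ 2 / β ^ 2, by positivity, fun u => ?_, fun x => by simp [hX]⟩
    rw [mul_div_cancel₀ _ (by positivity)]
    exact vecMul_dotProduct_self_le G u
  obtain ⟨x₀, hx₀⟩ := not_forall.1 hX
  let quotG (u : {u : m → ℝ // u ≠ 0}) : ℝ :=
    ((u.1 ᵥ* G) ⬝ᵥ (u.1 ᵥ* G)) / (β ^ 2 * (u.1 ⬝ᵥ u.1))
  let quotX (x : {x : n → ℝ // X *ᵥ x ≠ 0}) : ℝ :=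
    (((X *ᵥ x.1) ᵥ* X) ⬝ᵥ ((X *ᵥ x.1) ᵥ* X)) / ((X *ᵥ x.1) ⬝ᵥ (X *ᵥ x.1))
  have hpos {u : m → ℝ} (hu : u ≠ 0) : 0 < β ^ 2 * (u ⬝ᵥ u) :=
    mul_pos (pow_pos hβ 2) (dotProduct_self_pos hu)
  have hle (u x) : quotG u ≤ quotX x :=
    (div_le_div_iff₀ (hpos u.2) (dotProduct_self_pos x.2)).2 (h.opNorm_le u.1 x.1)
  obtain ⟨c, hcG, hcX⟩ : (upperBounds (Set.range quotG) ∩ lowerBounds (Set.range quotX)).Nonempty :=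
    exists_between_of_forall_le ⟨_, ⟨X *ᵥ x₀, hx₀⟩, rfl⟩ ⟨_, ⟨x₀, hx₀⟩, rfl⟩
      (Set.forall_mem_range.2 fun u => Set.forall_mem_range.2 fun x => hle u x)
  refine ⟨c, ?_, fun u => ?_, fun x => ?_⟩
  · exact (div_nonneg (dotProduct_self_nonneg _) (hpos hx₀).le).trans (hcG ⟨⟨X *ᵥ x₀, hx₀⟩, rfl⟩)
  · rcases eq_or_ne u 0 with rfl | hu
    · simp
    · linarith [(div_le_iff₀ (hpos hu)).1 (hcG ⟨⟨u, hu⟩, rfl⟩)]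
  · rcases eq_or_ne (X *ᵥ x) 0 with hx | hx
    · simp [hx]
    · exact (le_div_iff₀ (dotProduct_self_pos hx)).1 (hcX ⟨⟨x, hx⟩, rfl⟩)

theorem mul_sub_le_mul_sub {a b p s t : ℝ} (ha : 0 ≤ a) (hp : 0 ≤ p) (hps : p ≤ s) (hst : s ≤ t)
    (h : s * b ≤ t * a) : b * (s - p) ≤ a * (t - p) := by
  rcases le_total a b with hab | hba <;> nlinarith

theorem IsSpectrallyStationary.norm_proj_sq_le [DecidableEq k] (hβ : 0 < β)
    (h : IsSpectrallyStationary r β X G) (hk : Fintype.card k ≤ r)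
    (hkr : Fintype.card k * β ^ 2 ≤ r * α ^ 2) {P : Matrix m k ℝ} (hP : Pᵀ * P = 1) :
    ‖Pᵀ * G‖ ^ 2 ≤ α ^ 2 * ‖X - P * (Pᵀ * X)‖ ^ 2 := by
  rcases h.rank_le.lt_or_eq with hlt | rfl
  · rw [h.eq_zero_of_rank_lt hlt, Matrix.mul_zero, norm_zero, zero_pow two_ne_zero]
    positivity
  obtain ⟨c, hc, hcG, hcX⟩ := h.exists_threshold hβ
  obtain ⟨W, L, hW, hWX, hL⟩ := exists_orthonormal_mul_eq X
  have hWG : Wᵀ * G = 0 := by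
    rw [← hL, transpose_mul, Matrix.mul_assoc, h.transpose_mul_eq_zero, Matrix.mul_zero]
  have hcW (y) : c * (y ⬝ᵥ y) ≤ (y ᵥ* (Wᵀ * X)) ⬝ᵥ (y ᵥ* (Wᵀ * X)) := by
    have hy := hcX (L *ᵥ y)
    rwa [mulVec_mulVec, hL, dotProduct_mulVec, ← mulVec_transpose, mulVec_mulVec, hW, one_mulVec,
      ← vecMul_transpose, vecMul_vecMul] at hy
  have hX := le_norm_sub_proj_sq hP hW hWX hcW
  rw [Fintype.card_fin] at hX
  calc ‖Pᵀ * G‖ ^ 2 ≤ β ^ 2 * c * (Fintype.card k - ‖Pᵀ * W‖ ^ 2) :=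
        norm_transpose_mul_sq_le hP hW hWG hcG
    _ = c * (β ^ 2 * (Fintype.card k - ‖Pᵀ * W‖ ^ 2)) := by ring
    _ ≤ c * (α ^ 2 * (X.rank - ‖Pᵀ * W‖ ^ 2)) :=
        mul_le_mul_of_nonneg_left (mul_sub_le_mul_sub (sq_nonneg _) (sq_nonneg _)
          (norm_transpose_mul_sq_le_card hP hW) (Nat.cast_le.2 hk) hkr) hc
    _ = α ^ 2 * (c * (X.rank - ‖Pᵀ * W‖ ^ 2)) := by ring
    _ ≤ α ^ 2 * ‖X - P * (Pᵀ * X)‖ ^ 2 := by gcongr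

theorem norm_mul_smul_sub_sq (α : ℝ) (h : G * Xᵀ = 0) (A : Matrix k m ℝ) :
    ‖A * (α • X - G)‖ ^ 2 = α ^ 2 * ‖A * X‖ ^ 2 + ‖A * G‖ ^ 2 := by
  have horth : ⟪A * X, A * G⟫_ℝ = 0 := by
    rw [real_inner_comm, inner_matrix_mul', Matrix.mul_assoc, h, Matrix.mul_zero, inner_zero_left]
  rw [Matrix.mul_sub, Matrix.mul_smul, norm_sub_sq_real, real_inner_smul_left, horth, norm_smul_sq]
  ring

theorem IsSpectrallyStationary.norm_sq_le_norm_smul_sub_sq (hβ : 0 < β)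
    (h : IsSpectrallyStationary r β X G) (hYr : Y.rank ≤ r) (hY : Y.rank * β ^ 2 ≤ r * α ^ 2) :
    ‖G‖ ^ 2 ≤ ‖α • X - G - α • Y‖ ^ 2 := by
  classical
  obtain ⟨P, -, hP, hPY, -⟩ := exists_orthonormal_mul_eq Y
  have hPG := h.norm_proj_sq_le (α := α) hβ (by simpa using hYr) (by simpa using hY) hP
  have hZ := norm_mul_smul_sub_sq α h.mul_transpose_eq_zero (1 : Matrix m m ℝ)
  rw [Matrix.one_mul, Matrix.one_mul, Matrix.one_mul] at hZ
  calc ‖G‖ ^ 2 ≤ ‖α • X - G‖ ^ 2 - ‖Pᵀ * (α • X - G)‖ ^ 2 := by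
        rw [norm_sub_proj_sq hP] at hPG
        rw [hZ, norm_mul_smul_sub_sq α h.mul_transpose_eq_zero]
        linarith
    _ = ‖α • X - G - P * (Pᵀ * (α • X - G))‖ ^ 2 := (norm_sub_proj_sq hP _).symm
    _ ≤ ‖α • X - G - α • Y‖ ^ 2 :=
        norm_sub_proj_sq_le hP _ (by rw [Matrix.mul_smul, Matrix.mul_smul, hPY])

theorem IsSpectrallyStationary.inner_add_norm_sq_nonneg (hα : 0 < α) (hβ : 0 < β)
    (h : IsSpectrallyStationary r β X G) (hYr : Y.rank ≤ r) (hY : Y.rank * β ^ 2 ≤ r * α ^ 2) :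
    0 ≤ ⟪G, Y - X⟫_ℝ + α / 2 * ‖X - Y‖ ^ 2 := by
  have hle := h.norm_sq_le_norm_smul_sub_sq hβ hYr hY
  have hexpand : ‖α • X - G - α • Y‖ ^ 2 =
      ‖G‖ ^ 2 + 2 * α * (⟪G, Y - X⟫_ℝ + α / 2 * ‖X - Y‖ ^ 2) := by
    rw [sub_right_comm, ← smul_sub, norm_sub_sq_real, norm_smul_sq, real_inner_smul_left,
      ← neg_sub Y X, inner_neg_left, real_inner_comm]
    ring
  have : 0 ≤ 2 * α * (⟪G, Y - X⟫_ℝ + α / 2 * ‖X - Y‖ ^ 2) := by linarith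
  exact nonneg_of_mul_nonneg_right this (by positivity)

end SpectralStationarity

theorem IsSpectrallyStationary.le_of_rank_le {m n r : ℕ} {f : Matrix (Fin m) (Fin n) ℝ → ℝ}
    {α β : ℝ} {X Y : Matrix (Fin m) (Fin n) ℝ} (hα : 0 < α) (hβ : 0 < β)
    (hf : RestrictedStronglyConvex f r α) (h : IsSpectrallyStationary r β X (gradMatrix f X))
    (hYr : Y.rank ≤ r) (hY : Y.rank * β ^ 2 ≤ r * α ^ 2) : f X ≤ f Y := by
  have hlower := hf X Y h.rank_le hYr
  rw [frobInner_eq_inner] at hlower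
  linarith [h.inner_add_norm_sq_nonneg hα hβ hYr hY]

theorem eq_zero_of_forall_quadratic_nonneg {b c : ℝ} (h : ∀ t : ℝ, 0 ≤ t * b + t ^ 2 * c) :
    b = 0 := by
  have hd := discrim_le_zero (a := c) (b := b) (c := 0) fun t => by linarith [h t]
  simp only [discrim, mul_zero, sub_zero] at hd
  exact sq_nonpos_iff b |>.1 hd

section ProjectedGradient

variable {m n r : ℕ} {β : ℝ} {X G : Matrix (Fin m) (Fin n) ℝ}

theorem IsRankProjection.inner_add_norm_sq_nonneg (hβ : 0 < β)
    (h : IsRankProjection r (X - (1 / β) • G) X) {D : Matrix (Fin m) (Fin n) ℝ}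
    (hD : (X + D).rank ≤ r) : 0 ≤ ⟪G, D⟫_ℝ + β / 2 * ‖D‖ ^ 2 := by
  have hmin : ‖(1 / β) • G‖ ^ 2 ≤ ‖(1 / β) • G + D‖ ^ 2 := by
    have hle := h.2 _ hD
    rw [sub_sub_cancel, add_sub_sub_cancel, add_comm D] at hle
    gcongr
  rw [norm_add_sq_real, real_inner_smul_left] at hmin
  have hscale : ⟪G, D⟫_ℝ + β / 2 * ‖D‖ ^ 2 =
      β / 2 * (2 * (1 / β * ⟪G, D⟫_ℝ) + ‖D‖ ^ 2) := by
    field_simp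
  rw [hscale]
  exact mul_nonneg (by positivity) (by linarith)

theorem IsRankProjection.inner_eq_zero (hβ : 0 < β)
    (h : IsRankProjection r (X - (1 / β) • G) X) {D : Matrix (Fin m) (Fin n) ℝ}
    (hD : ∀ t : ℝ, (X + t • D).rank ≤ r) : ⟪G, D⟫_ℝ = 0 :=
  eq_zero_of_forall_quadratic_nonneg (c := β / 2 * ‖D‖ ^ 2) fun t => by
    have := h.inner_add_norm_sq_nonneg hβ (hD t)
    rw [real_inner_smul_right, norm_smul_sq] at this
    linarith

theorem IsRankProjection.mul_transpose_eq_zero (hβ : 0 < β)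
    (h : IsRankProjection r (X - (1 / β) • G) X) : G * Xᵀ = 0 := by
  rw [← inner_self_eq_zero (𝕜 := ℝ), ← inner_matrix_mul']
  refine h.inner_eq_zero hβ fun t => ?_
  have hfactor : X + t • (G * Xᵀ * X) = (1 + t • (G * Xᵀ)) * X := by
    rw [Matrix.add_mul, Matrix.one_mul, Matrix.smul_mul]
  exact hfactor ▸ (rank_mul_le_right _ _).trans h.1

theorem IsRankProjection.transpose_mul_eq_zero (hβ : 0 < β)
    (h : IsRankProjection r (X - (1 / β) • G) X) : Xᵀ * G = 0 := by
  rw [← inner_self_eq_zero (𝕜 := ℝ), ← inner_matrix_mul]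
  refine h.inner_eq_zero hβ fun t => ?_
  have hfactor : X + t • (X * (Xᵀ * G)) = X * (1 + t • (Xᵀ * G)) := by
    rw [Matrix.mul_add, Matrix.mul_one, Matrix.mul_smul]
  exact hfactor ▸ (rank_mul_le_left _ _).trans h.1

theorem IsRankProjection.eq_zero_of_rank_lt (hβ : 0 < β)
    (h : IsRankProjection r (X - (1 / β) • G) X) (hr : X.rank < r) : G = 0 :=
  eq_zero_of_forall_inner_vecMulVec_eq_zero fun u v => h.inner_eq_zero hβ fun t => by
    rw [← smul_vecMulVec]
    exact (rank_add_vecMulVec_le X (t • u) v).trans hr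

-- The competitor trades the direction `X *ᵥ x` of the column space for a step along `u`.
theorem IsRankProjection.opNorm_le (hβ : 0 < β) (h : IsRankProjection r (X - (1 / β) • G) X)
    (u : Fin m → ℝ) (x : Fin n → ℝ) :
    ((u ᵥ* G) ⬝ᵥ (u ᵥ* G)) * ((X *ᵥ x) ⬝ᵥ (X *ᵥ x)) ≤
      ((X *ᵥ x) ᵥ* X) ⬝ᵥ ((X *ᵥ x) ᵥ* X) * (β ^ 2 * (u ⬝ᵥ u)) := by
  rcases eq_or_ne u 0 with rfl | hu
  · simp
  rcases eq_or_ne (X *ᵥ x) 0 with hx | hx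
  · simp [hx]
  set w := X *ᵥ x
  have hu' := dotProduct_self_pos hu
  have hw' := dotProduct_self_pos hx
  have horth := vecMul_dotProduct_vecMul_eq_zero (h.mul_transpose_eq_zero hβ)
  set D := vecMulVec (-(w ⬝ᵥ w)⁻¹ • w) (w ᵥ* X) + vecMulVec (-(β * (u ⬝ᵥ u))⁻¹ • u) (u ᵥ* G)
  have hrank : (X + D).rank ≤ r := calc
    (X + D).rank ≤ (X + vecMulVec (-(w ⬝ᵥ w)⁻¹ • w) (w ᵥ* X)).rank + 1 := by
      rw [← add_assoc]
      exact rank_add_vecMulVec_le _ _ _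
    _ ≤ X.rank := rank_add_vecMulVec_lt X hw'.ne'
    _ ≤ r := h.1
  have hinner : ⟪G, D⟫_ℝ = -(β * (u ⬝ᵥ u))⁻¹ * ((u ᵥ* G) ⬝ᵥ (u ᵥ* G)) := by
    rw [inner_add_right, inner_vecMulVec, inner_vecMulVec, smul_vecMul, smul_vecMul,
      smul_dotProduct, smul_dotProduct, dotProduct_comm (w ᵥ* G), horth, smul_zero, zero_add,
      smul_eq_mul]
  have hmodel := h.inner_add_norm_sq_nonneg hβ hrank
  rw [hinner, norm_vecMulVec_add_vecMulVec_sq (horth u w)] at hmodel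
  have hgap : 0 ≤ β / 2 * (((w ᵥ* X) ⬝ᵥ (w ᵥ* X)) / (w ⬝ᵥ w) -
      ((u ᵥ* G) ⬝ᵥ (u ᵥ* G)) / (β ^ 2 * (u ⬝ᵥ u))) := by
    refine hmodel.trans_eq ?_
    simp only [smul_dotProduct, dotProduct_smul, smul_eq_mul]
    field_simp
    ring
  exact (div_le_div_iff₀ (by positivity) hw').1
    (sub_nonneg.1 (nonneg_of_mul_nonneg_right hgap (by positivity)))

theorem IsRankProjection.isSpectrallyStationary (hβ : 0 < β)
    (h : IsRankProjection r (X - (1 / β) • G) X) : IsSpectrallyStationary r β X G where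
  rank_le := h.1
  mul_transpose_eq_zero := h.mul_transpose_eq_zero hβ
  transpose_mul_eq_zero := h.transpose_mul_eq_zero hβ
  eq_zero_of_rank_lt := h.eq_zero_of_rank_lt hβ
  opNorm_le := h.opNorm_le hβ

end ProjectedGradient

section Calculus

theorem eventually_le_add_mul_sq {φ φ' : ℝ → ℝ} {a ε : ℝ} (hφ : ∀ t, HasDerivAt φ (φ' t) t)
    (hφ' : HasDerivAt φ' a 0) (h0 : φ' 0 = 0) (ha : 0 ≤ a) (hε : 0 < ε) :
    ∀ᶠ t in 𝓝 0, φ 0 ≤ φ t + ε * t ^ 2 := by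
  have hd (t : ℝ) : HasDerivAt (fun t => φ t + ε * t ^ 2) (φ' t + ε * (2 * t)) t := by
    simpa using (hφ t).fun_add ((hasDerivAt_pow 2 t).const_mul ε)
  have hderiv : deriv (fun t => φ t + ε * t ^ 2) = fun t => φ' t + ε * (2 * t) :=
    deriv_eq hd
  have hdd : HasDerivAt (fun t => φ' t + ε * (2 * t)) (a + ε * 2) 0 := by
    simpa using hφ'.fun_add (((hasDerivAt_id (0 : ℝ)).const_mul 2).const_mul ε)
  have hmin : IsLocalMin (fun t => φ t + ε * t ^ 2) 0 := by
    refine isLocalMin_of_deriv_deriv_pos ?_ (by simp [hderiv, h0]) (hd 0).continuousAt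
    rw [hderiv, hdd.deriv]
    positivity
  filter_upwards [hmin] with t ht
  simpa using ht

theorem nonneg_of_le_add_sq_mul {φ φ' ρ : ℝ → ℝ} {a : ℝ} (hφ : ∀ t, HasDerivAt φ (φ' t) t)
    (hφ' : HasDerivAt φ' a 0) (h0 : φ' 0 = 0) (ha : 0 ≤ a) (hρ : ContinuousAt ρ 0)
    (hle : ∀ t, φ t ≤ φ 0 + t ^ 2 * ρ t) : 0 ≤ ρ 0 := by
  refine le_of_forall_pos_le_add fun ε hε => ?_
  have hev : ∀ᶠ t in 𝓝[≠] 0, 0 ≤ ρ t + ε := by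
    filter_upwards [nhdsWithin_le_nhds (eventually_le_add_mul_sq hφ hφ' h0 ha hε),
      self_mem_nhdsWithin] with t ht hne
    have hmul : 0 ≤ t ^ 2 * (ρ t + ε) := by linarith [hle t]
    exact nonneg_of_mul_nonneg_right hmul (sq_pos_of_ne_zero hne)
  exact ge_of_tendsto (hρ.tendsto.mono_left nhdsWithin_le_nhds |>.add_const ε) hev

theorem nonneg_of_le_add_sq_mul_of_fderiv_eq_zero {E : Type*} [NormedAddCommGroup E]
    [NormedSpace ℝ E] {g : E → ℝ} (hg : Differentiable ℝ g) {p d : E}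
    (hg' : DifferentiableAt ℝ (fderiv ℝ g) p) (h1 : fderiv ℝ g p = 0)
    (h2 : 0 ≤ fderiv ℝ (fderiv ℝ g) p d d) {ρ : ℝ → ℝ} (hρ : ContinuousAt ρ 0)
    (hle : ∀ t : ℝ, g (p + t • d) ≤ g p + t ^ 2 * ρ t) : 0 ≤ ρ 0 := by
  have hline (t : ℝ) : HasDerivAt (fun t : ℝ => p + t • d) d t := by
    simpa using ((hasDerivAt_id t).smul_const d).const_add p
  have hφ (t : ℝ) : HasDerivAt (fun t : ℝ => g (p + t • d)) (fderiv ℝ g (p + t • d) d) t :=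
    (hg _).hasFDerivAt.comp_hasDerivAt t (hline t)
  have hφ' : HasDerivAt (fun t : ℝ => fderiv ℝ g (p + t • d) d)
      (fderiv ℝ (fderiv ℝ g) p d d) 0 := by
    have hg'' : HasFDerivAt (fderiv ℝ g) (fderiv ℝ (fderiv ℝ g) p) (p + (0 : ℝ) • d) := by
      rw [zero_smul, add_zero]
      exact hg'.hasFDerivAt
    have hcomp := hg''.comp_hasDerivAt (0 : ℝ) (hline 0)
    simpa using hcomp.clm_apply (hasDerivAt_const (0 : ℝ) d)
  refine nonneg_of_le_add_sq_mul hφ hφ' (by simp [h1]) h2 hρ fun t => ?_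
  rw [zero_smul, add_zero]
  exact hle t

theorem isBoundedBilinearMap_mul_transpose {m n k : Type*} [Fintype m] [Fintype n] [Fintype k] :
    IsBoundedBilinearMap ℝ fun p : Matrix m k ℝ × Matrix n k ℝ => p.1 * p.2ᵀ where
  add_left _ _ _ := Matrix.add_mul _ _ _
  smul_left _ _ _ := Matrix.smul_mul _ _ _
  add_right _ _ _ := by rw [transpose_add, Matrix.mul_add]
  smul_right _ _ _ := by rw [transpose_smul, Matrix.mul_smul]
  bound := ⟨1, one_pos, fun A B => by
    rw [one_mul, ← frobenius_norm_transpose B]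
    exact frobenius_norm_mul _ _⟩

variable {m n r : ℕ} {f : Matrix (Fin m) (Fin n) ℝ → ℝ}

theorem fderiv_apply_eq_inner_gradMatrix (f : Matrix (Fin m) (Fin n) ℝ → ℝ)
    (X H : Matrix (Fin m) (Fin n) ℝ) : fderiv ℝ f X H = ⟪gradMatrix f X, H⟫_ℝ := by
  have hsingle (i j) : single i j (H i j) = H i j • single i j (1 : ℝ) := by
    rw [smul_single, smul_eq_mul, mul_one]
  conv_lhs => rw [matrix_eq_sum_single H]
  simp only [hsingle, map_sum, map_smul, ← frobInner_eq_inner, frobInner, gradMatrix, of_apply,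
    smul_eq_mul, mul_comm]

theorem hasFDerivAt_factorized (hf : Differentiable ℝ f)
    (p : Matrix (Fin m) (Fin r) ℝ × Matrix (Fin n) (Fin r) ℝ) :
    HasFDerivAt (factorized f r)
      ((fderiv ℝ f (p.1 * p.2ᵀ)).comp (isBoundedBilinearMap_mul_transpose.deriv p)) p :=
  (hf _).hasFDerivAt.comp p (isBoundedBilinearMap_mul_transpose.hasFDerivAt p)

theorem fderiv_factorized (hf : Differentiable ℝ f)
    (p : Matrix (Fin m) (Fin r) ℝ × Matrix (Fin n) (Fin r) ℝ) :
    fderiv ℝ (factorized f r) p =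
      (fderiv ℝ f (p.1 * p.2ᵀ)).comp (isBoundedBilinearMap_mul_transpose.deriv p) :=
  (hasFDerivAt_factorized hf p).fderiv

theorem fderiv_factorized_apply (hf : Differentiable ℝ f) (A U : Matrix (Fin m) (Fin r) ℝ)
    (B V : Matrix (Fin n) (Fin r) ℝ) : fderiv ℝ (factorized f r) (A, B) (U, V) =
      ⟪gradMatrix f (A * Bᵀ), A * Vᵀ + U * Bᵀ⟫_ℝ := by
  rw [fderiv_factorized hf, ← fderiv_apply_eq_inner_gradMatrix]
  rfl

theorem differentiable_fderiv_factorized (hf : TwiceDifferentiable f) :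
    Differentiable ℝ (fderiv ℝ (factorized f r)) := by
  have hb := isBoundedBilinearMap_mul_transpose (m := Fin m) (n := Fin n) (k := Fin r)
  rw [funext (fderiv_factorized hf.1)]
  exact fun p => ((hf.2 _).comp p (hb.differentiableAt p)).clm_comp
    (hb.isBoundedLinearMap_deriv.differentiable p)

end Calculus

theorem rank_mul_transpose_le {m n k K : Type*} [Fintype n] [Fintype k] [Field K]
    (A : Matrix m k K) (B : Matrix n k K) : (A * Bᵀ).rank ≤ Fintype.card k :=
  (rank_mul_le_left A Bᵀ).trans (rank_le_card_width A)

section Factorized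

variable {m n r : ℕ} {f : Matrix (Fin m) (Fin n) ℝ → ℝ} {β : ℝ}
  {A : Matrix (Fin m) (Fin r) ℝ} {B : Matrix (Fin n) (Fin r) ℝ}

theorem IsFactorizedSOSP.inner_eq_zero (hf : Differentiable ℝ f) (h : IsFactorizedSOSP f r (A, B))
    (U : Matrix (Fin m) (Fin r) ℝ) (V : Matrix (Fin n) (Fin r) ℝ) :
    ⟪gradMatrix f (A * Bᵀ), A * Vᵀ + U * Bᵀ⟫_ℝ = 0 := by
  rw [← fderiv_factorized_apply hf, h.1]
  rfl

theorem IsFactorizedSOSP.gradMatrix_mul_transpose_eq_zero (hf : Differentiable ℝ f)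
    (h : IsFactorizedSOSP f r (A, B)) : gradMatrix f (A * Bᵀ) * (A * Bᵀ)ᵀ = 0 := by
  have hU := h.inner_eq_zero hf (gradMatrix f (A * Bᵀ) * B) 0
  rw [transpose_zero, Matrix.mul_zero, zero_add, inner_matrix_mul', transpose_transpose,
    inner_self_eq_zero] at hU
  rw [transpose_mul, transpose_transpose, ← Matrix.mul_assoc, hU, Matrix.zero_mul]

theorem IsFactorizedSOSP.transpose_mul_gradMatrix_eq_zero (hf : Differentiable ℝ f)
    (h : IsFactorizedSOSP f r (A, B)) : (A * Bᵀ)ᵀ * gradMatrix f (A * Bᵀ) = 0 := by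
  have hV := h.inner_eq_zero hf 0 (Aᵀ * gradMatrix f (A * Bᵀ))ᵀ
  rw [transpose_transpose, Matrix.zero_mul, add_zero, inner_matrix_mul,
    inner_self_eq_zero] at hV
  rw [transpose_mul, transpose_transpose, Matrix.mul_assoc, hV, Matrix.mul_zero]

theorem IsFactorizedSOSP.inner_add_norm_sq_nonneg (hf : TwiceDifferentiable f)
    (hsm : RestrictedSmooth f r β) (h : IsFactorizedSOSP f r (A, B))
    (U : Matrix (Fin m) (Fin r) ℝ) (V : Matrix (Fin n) (Fin r) ℝ) :
    0 ≤ ⟪gradMatrix f (A * Bᵀ), U * Vᵀ⟫_ℝ + β / 2 * ‖A * Vᵀ + U * Bᵀ‖ ^ 2 := by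
  set G := gradMatrix f (A * Bᵀ)
  set D := A * Vᵀ + U * Bᵀ
  let ρ (t : ℝ) : ℝ := ⟪G, U * Vᵀ⟫_ℝ + β / 2 * ‖D + t • (U * Vᵀ)‖ ^ 2
  have hmodel (t : ℝ) : factorized f r ((A, B) + t • (U, V)) ≤
      factorized f r (A, B) + t ^ 2 * ρ t := by
    have hcurve : (A + t • U) * (B + t • V)ᵀ - A * Bᵀ = t • (D + t • (U * Vᵀ)) := by
      simp only [D, transpose_add, transpose_smul, Matrix.mul_add, Matrix.add_mul, Matrix.mul_smul,
        Matrix.smul_mul, smul_add]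
      abel
    have hle := hsm (A * Bᵀ) ((A + t • U) * (B + t • V)ᵀ)
      (by simpa using rank_mul_transpose_le A B)
      (by simpa using rank_mul_transpose_le (A + t • U) (B + t • V))
    rw [frobInner_eq_inner, norm_sub_rev, hcurve, real_inner_smul_right, inner_add_right,
      h.inner_eq_zero hf.1, real_inner_smul_right, norm_smul_sq] at hle
    refine hle.trans_eq ?_
    change f (A * Bᵀ) + _ + _ = f (A * Bᵀ) + _
    ring
  have hρ : Continuous ρ := by fun_prop
  simpa [ρ] using nonneg_of_le_add_sq_mul_of_fderiv_eq_zero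
    (fun p => (hasFDerivAt_factorized hf.1 p).differentiableAt)
    (differentiable_fderiv_factorized hf _) h.1 (h.2 (U, V)) hρ.continuousAt hmodel

theorem IsFactorizedSOSP.inner_mul_transpose_eq_zero (hf : TwiceDifferentiable f)
    (hsm : RestrictedSmooth f r β) (h : IsFactorizedSOSP f r (A, B))
    {U : Matrix (Fin m) (Fin r) ℝ} {V : Matrix (Fin n) (Fin r) ℝ}
    (hUV : A * Vᵀ = 0 ∨ U * Bᵀ = 0) : ⟪gradMatrix f (A * Bᵀ), U * Vᵀ⟫_ℝ = 0 := by
  refine eq_zero_of_forall_quadratic_nonneg (c := β / 2 * ‖A * Vᵀ + U * Bᵀ‖ ^ 2) fun t => ?_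
  rcases hUV with hAV | hUB
  · have ht := h.inner_add_norm_sq_nonneg hf hsm (t • U) V
    rw [hAV, zero_add, Matrix.smul_mul, Matrix.smul_mul, real_inner_smul_right,
      norm_smul_sq] at ht
    rw [hAV, zero_add]
    linarith
  · have ht := h.inner_add_norm_sq_nonneg hf hsm U (t • V)
    rw [hUB, add_zero, transpose_smul, Matrix.mul_smul, Matrix.mul_smul, real_inner_smul_right,
      norm_smul_sq] at ht
    rw [hUB, add_zero]
    linarith

theorem IsFactorizedSOSP.gradMatrix_eq_zero_of_rank_lt (hf : TwiceDifferentiable f)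
    (hsm : RestrictedSmooth f r β) (h : IsFactorizedSOSP f r (A, B)) (hr : (A * Bᵀ).rank < r) :
    gradMatrix f (A * Bᵀ) = 0 := by
  obtain ⟨z, hz, hAB⟩ := exists_mulVec_eq_zero_of_rank_mul_transpose_lt (A := A) (B := B)
    (by rwa [Fintype.card_fin])
  refine eq_zero_of_forall_inner_vecMulVec_eq_zero fun u v => ?_
  have hUV : A * (vecMulVec v z)ᵀ = 0 ∨ vecMulVec u z * Bᵀ = 0 := by
    refine hAB.imp (fun hA => ?_) (fun hB => ?_)
    · rw [transpose_vecMulVec, mul_vecMulVec, hA, zero_vecMulVec]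
    · rw [vecMulVec_mul, vecMul_transpose, hB]
      exact Matrix.ext fun i _ => mul_zero (u i)
  have hinner := h.inner_mul_transpose_eq_zero hf hsm hUV
  rw [transpose_vecMulVec, vecMulVec_mul_vecMulVec, vecMulVec_smul, real_inner_smul_right] at hinner
  exact (mul_eq_zero.1 hinner).resolve_left (dotProduct_self_pos hz).ne'

theorem IsFactorizedSOSP.opNorm_le (hf : TwiceDifferentiable f) (hβ : 0 < β)
    (hsm : RestrictedSmooth f r β) (h : IsFactorizedSOSP f r (A, B))
    {X : Matrix (Fin m) (Fin n) ℝ} (hX : X = A * Bᵀ) (u : Fin m → ℝ) (x : Fin n → ℝ) :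
    ((u ᵥ* gradMatrix f X) ⬝ᵥ (u ᵥ* gradMatrix f X)) * ((X *ᵥ x) ⬝ᵥ (X *ᵥ x)) ≤
      ((X *ᵥ x) ᵥ* X) ⬝ᵥ ((X *ᵥ x) ᵥ* X) * (β ^ 2 * (u ⬝ᵥ u)) := by
  set G := gradMatrix f X with hG
  set w := X *ᵥ x
  set v := u ᵥ* G
  set U := vecMulVec u (w ᵥ* A)
  set V := vecMulVec (-(1 / β) • v) (x ᵥ* B)
  have hGX : G * Xᵀ = 0 := by rw [hG, hX, h.gradMatrix_mul_transpose_eq_zero hf.1]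
  have hAV : A * Vᵀ = vecMulVec w (-(1 / β) • v) := by
    rw [transpose_vecMulVec, mul_vecMulVec, ← mulVec_transpose, mulVec_mulVec, ← hX]
  have hUB : U * Bᵀ = vecMulVec u (w ᵥ* X) := by
    rw [vecMulVec_mul, vecMul_vecMul, ← hX]
  have hUV : U * Vᵀ = (w ⬝ᵥ w) • vecMulVec u (-(1 / β) • v) := by
    have hw : (w ᵥ* A) ⬝ᵥ (x ᵥ* B) = w ⬝ᵥ w := by
      rw [← mulVec_transpose B, dotProduct_mulVec, vecMul_vecMul, ← hX, ← dotProduct_mulVec]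
    rw [transpose_vecMulVec, vecMulVec_mul_vecMulVec, hw, vecMulVec_smul]
  have horth : (-(1 / β) • v) ⬝ᵥ (w ᵥ* X) = 0 := by
    rw [smul_dotProduct, dotProduct_comm, vecMul_dotProduct_vecMul_eq_zero hGX, smul_zero]
  have hcurv := h.inner_add_norm_sq_nonneg hf hsm U V
  rw [hAV, hUB, norm_vecMulVec_add_vecMulVec_sq horth, hUV, real_inner_smul_right,
    inner_vecMulVec, ← hX, ← hG] at hcurv
  have hgap : 0 ≤ 1 / (2 * β) *
      ((w ᵥ* X) ⬝ᵥ (w ᵥ* X) * (β ^ 2 * (u ⬝ᵥ u)) - (v ⬝ᵥ v) * (w ⬝ᵥ w)) := by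
    refine hcurv.trans_eq ?_
    simp only [smul_dotProduct, dotProduct_smul, smul_eq_mul]
    field_simp
    ring
  exact sub_nonneg.1 (nonneg_of_mul_nonneg_right hgap (by positivity))

theorem IsFactorizedSOSP.isSpectrallyStationary (hf : TwiceDifferentiable f) (hβ : 0 < β)
    (hsm : RestrictedSmooth f r β) (h : IsFactorizedSOSP f r (A, B)) :
    IsSpectrallyStationary r β (A * Bᵀ) (gradMatrix f (A * Bᵀ)) where
  rank_le := by simpa using rank_mul_transpose_le A B
  mul_transpose_eq_zero := h.gradMatrix_mul_transpose_eq_zero hf.1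
  transpose_mul_eq_zero := h.transpose_mul_gradMatrix_eq_zero hf.1
  eq_zero_of_rank_lt := h.gradMatrix_eq_zero_of_rank_lt hf hsm
  opNorm_le := h.opNorm_le hf hβ hsm rfl

end Factorized

section Attainment

theorem isClosed_setOf_rank_lt {m n 𝕜 : Type*} [Finite m] [Fintype n]
    [NontriviallyNormedField 𝕜] [CompleteSpace 𝕜] (c : ℝ) :
    IsClosed {Y : Matrix m n 𝕜 | (Y.rank : ℝ) < c} := by
  classical
  have := Fintype.ofFinite m
  let T : Matrix m n 𝕜 →ₗ[𝕜] ((n → 𝕜) →L[𝕜] (m → 𝕜)) :=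
    LinearMap.toContinuousLinearMap.toLinearMap ∘ₗ (Matrix.toLin' (R := 𝕜)).toLinearMap
  have hT : Continuous T := T.continuous_of_finiteDimensional
  rw [← isOpen_compl_iff]
  convert (isOpen_setOfPred_nat_le_rank (𝕜 := 𝕜) (E := n → 𝕜) (F := m → 𝕜)
    ⌈c⌉₊).preimage hT using 1
  ext Y
  have hrank : ((T Y : (n → 𝕜) →L[𝕜] (m → 𝕜)) : (n → 𝕜) →ₗ[𝕜] (m → 𝕜)).rank = Y.rank :=
    (Module.finrank_eq_rank 𝕜 (LinearMap.range (Matrix.toLin' Y))).symm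
  simp only [Set.mem_compl_iff, Set.mem_ofPred_eq, not_lt, Set.mem_preimage, hrank, Nat.cast_le,
    Nat.ceil_le]

variable {m n r : ℕ} {f : Matrix (Fin m) (Fin n) ℝ → ℝ} {α β κ : ℝ}

theorem RestrictedStronglyConvex.mem_closedBall (hα : 0 < α) (hf : RestrictedStronglyConvex f r α)
    {X Y : Matrix (Fin m) (Fin n) ℝ} (hX : X.rank ≤ r) (hY : Y.rank ≤ r) (hle : f Y ≤ f X) :
    Y ∈ Metric.closedBall X (2 / α * ‖gradMatrix f X‖) := by
  have hconv := hf X Y hX hY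
  rw [frobInner_eq_inner, norm_sub_rev] at hconv
  have hcs := neg_le_of_abs_le (abs_real_inner_le_norm (gradMatrix f X) (Y - X))
  rw [mem_closedBall_iff_norm, div_mul_eq_mul_div, le_div_iff₀ hα]
  rcases (norm_nonneg (Y - X)).eq_or_lt with h0 | hpos
  · rw [← h0, zero_mul]
    positivity
  · nlinarith

theorem RestrictedStronglyConvex.exists_isLeast_image (hα : 0 < α)
    (hf : RestrictedStronglyConvex f r α) (hcont : Continuous f)
    {S : Set (Matrix (Fin m) (Fin n) ℝ)} (hS : IsClosed S) (hne : S.Nonempty)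
    (hrank : ∀ Y ∈ S, Y.rank ≤ r) : ∃ μ, IsLeast (f '' S) μ := by
  obtain ⟨X, hX⟩ := hne
  have : ProperSpace (Matrix (Fin m) (Fin n) ℝ) := FiniteDimensional.proper ℝ _
  have hfar : ∀ᶠ Y in cocompact _ ⊓ 𝓟 S, f X ≤ f Y := by
    rw [eventually_inf_principal]
    filter_upwards [(isCompact_closedBall X (2 / α * ‖gradMatrix f X‖)).compl_mem_cocompact]
      with Y hY hYS
    exact le_of_not_ge fun hle => hY (hf.mem_closedBall hα (hrank X hX) (hrank Y hYS) hle)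
  obtain ⟨Y, hY, hmin⟩ := hcont.continuousOn.exists_isMinOn' hS hX hfar
  exact ⟨f Y, ⟨Y, hY, rfl⟩, Set.forall_mem_image.2 hmin⟩

theorem RestrictedStronglyConvex.le_of_restrictedSmooth (hconv : RestrictedStronglyConvex f r α)
    (hsm : RestrictedSmooth f r β) {X Y : Matrix (Fin m) (Fin n) ℝ} (hX : X.rank ≤ r)
    (hY : Y.rank ≤ r) (hne : X ≠ Y) : α ≤ β := by
  have hpos : 0 < ‖X - Y‖ ^ 2 := pow_pos (norm_pos_iff.2 (sub_ne_zero.2 hne)) 2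
  have hle : α / 2 * ‖X - Y‖ ^ 2 ≤ β / 2 * ‖X - Y‖ ^ 2 := by
    linarith [hconv X Y hX hY, hsm X Y hX hY]
  linarith [le_of_mul_le_mul_right hle hpos]

theorem rank_le_of_rank_mul_sq_le (hα : 0 < α) (hβ : 0 < β)
    (hconv : RestrictedStronglyConvex f r α) (hsm : RestrictedSmooth f r β)
    {Y : Matrix (Fin m) (Fin n) ℝ} (hY : Y.rank * β ^ 2 ≤ r * α ^ 2) : Y.rank ≤ r := by
  rcases Nat.eq_zero_or_pos Y.rank with h0 | hpos
  · exact h0.trans_le r.zero_le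
  have hr : (0 : ℝ) < r := pos_of_mul_pos_left
    (lt_of_lt_of_le (mul_pos (Nat.cast_pos.2 hpos) (pow_pos hβ 2)) hY) (sq_nonneg α)
  let i : Fin m := ⟨0, hpos.trans_le Y.rank_le_height⟩
  let j : Fin n := ⟨0, hpos.trans_le Y.rank_le_width⟩
  let E : Matrix (Fin m) (Fin n) ℝ := vecMulVec (Pi.single i 1) (Pi.single j 1)
  have hE : E ≠ 0 := fun h => by simpa [E, vecMulVec_apply] using congrFun₂ h i j
  have hαβ : α ≤ β := hconv.le_of_restrictedSmooth hsm
    ((rank_vecMulVec_le _ _).trans (Nat.cast_pos.1 hr)) (rank_zero.trans_le r.zero_le) hE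
  have hle : Y.rank * β ^ 2 ≤ r * β ^ 2 := hY.trans (by gcongr)
  exact Nat.cast_le.1 (le_of_mul_le_mul_right hle (by positivity))

end Attainment

end LowRankOpt

theorem theorem4_general (m n r : ℕ) (f : Matrix (Fin m) (Fin n) ℝ → ℝ)
    (hf : LowRankOpt.TwiceDifferentiable f)
    (α β κ : ℝ) (hα : 0 < α) (hβ : 0 < β) (hκ : κ = β / α)
    (hRSC : LowRankOpt.RestrictedStronglyConvex f r α)
    (hRSM : LowRankOpt.RestrictedSmooth f r β)
    {S : Set (Matrix (Fin m) (Fin n) ℝ)} (hS : IsClosed S) (hne : S.Nonempty)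
    (hrank : ∀ Y ∈ S, (Y.rank : ℝ) ≤ (r : ℝ) / κ ^ 2) :
    ∃ μ : ℝ,
      IsLeast (f '' S) μ ∧
      (∀ X : Matrix (Fin m) (Fin n) ℝ, LowRankOpt.IsPGDStationary f r (1 / β) X → f X ≤ μ) ∧
      (∀ (A : Matrix (Fin m) (Fin r) ℝ) (B : Matrix (Fin n) (Fin r) ℝ),
        LowRankOpt.IsFactorizedSOSP f r (A, B) → f (A * B.transpose) ≤ μ) := by
  have hsq (Y) (hY : Y ∈ S) : Y.rank * β ^ 2 ≤ r * α ^ 2 := by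
    have hle := hrank Y hY
    rwa [hκ, div_pow, div_div_eq_mul_div, le_div_iff₀ (by positivity)] at hle
  have hr (Y) (hY : Y ∈ S) : Y.rank ≤ r :=
    LowRankOpt.rank_le_of_rank_mul_sq_le hα hβ hRSC hRSM (hsq Y hY)
  obtain ⟨_, hμ⟩ := hRSC.exists_isLeast_image hα hf.1.continuous hS hne hr
  obtain ⟨Y, hY, rfl⟩ := hμ.1
  exact ⟨f Y, hμ, fun X hX => (hX.isSpectrallyStationary hβ).le_of_rank_le hα hβ hRSC
    (hr Y hY) (hsq Y hY), fun A B hAB => (hAB.isSpectrallyStationary hf hβ hRSM).le_of_rank_le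
    hα hβ hRSC (hr Y hY) (hsq Y hY)⟩

theorem theorem4 (m n r : ℕ) (hr : 0 < r) (f : Matrix (Fin m) (Fin n) ℝ → ℝ)
    (hf : LowRankOpt.TwiceDifferentiable f)
    (α β κ : ℝ) (hα : 0 < α) (hβ : 0 < β) (hκ : κ = β / α)
    (hRSC : LowRankOpt.RestrictedStronglyConvex f r α)
    (hRSM : LowRankOpt.RestrictedSmooth f r β) :
    ∃ μ : ℝ,
      IsLeast (f '' {Y : Matrix (Fin m) (Fin n) ℝ | (Y.rank : ℝ) < (r : ℝ) / κ ^ 2}) μ ∧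
      (∀ X : Matrix (Fin m) (Fin n) ℝ, LowRankOpt.IsPGDStationary f r (1 / β) X → f X ≤ μ) ∧
      (∀ (A : Matrix (Fin m) (Fin r) ℝ) (B : Matrix (Fin n) (Fin r) ℝ),
        LowRankOpt.IsFactorizedSOSP f r (A, B) → f (A * B.transpose) ≤ μ) :=
  theorem4_general m n r f hf α β κ hα hβ hκ hRSC hRSM (LowRankOpt.isClosed_setOf_rank_lt _)
    ⟨0, by subst hκ; simpa using by positivity⟩ fun _ => le_of_lt (α := ℝ)
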